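/- For an entire function $f$ write $f^n$ for its $n$th iterate and let $$I^{+}(f)=\{z\in\mathbb{C} : (f^n(z))_{n\in\mathbb{N}} \text{ is unbounded}\},\qquad m(r)=\min\{|f(z)| : |z|=r\}\quad (r\ge 0),$$ and let $m^n(r)$ denote the $n$th iterate of the function $r\mapsto m(r)$. A set $A\subset\mathbb{C}$ *surrounds* a set $B\subset\mathbb{C}$ if $B$ lies in a bounded component of $\mathbb{C}\setminus A$. Let $f(z)=-10\,z\,e^{-z}-\tfrac12 z$ and, for $n\ge 1$, let $$D_n=\{z : 0<\operatorname{Re} z<4n\pi,\ |\operatorname{Im} z|<4n\pi\}\ \cup\ \{z : -n\pi<\operatorname{Re} z\le 0,\ |\operatorname{Im} z|<n\pi\}.$$ Then: 1. $f$ is a transcendental entire function, that is, an entire function that is not a polynomial. 2. The sets $D_n$, $n\ge 2$, are bounded, simply connected domains such that (a) $f(\partial D_n)$ surrounds $D_{n+1}$ for every $n\ge 2$, and (b) every disc centred at $0$ is contained in $D_n$ for all sufficiently large $n$. 3. $I^{+}(f)$ is connected. 4. There is no $r>0$ such that $m^n(r)\to\infty$ as $n\to\infty$. -/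

import Mathlib

open Set Filter Topology

/-- A transcendental entire function: holomorphic on the whole plane and not a polynomial. -/
def IsTranscendentalEntire (f : ℂ → ℂ) : Prop :=
  Differentiable ℂ f ∧ ¬ ∃ p : Polynomial ℂ, ∀ z, f z = p.eval z

/-- `I⁺(f)`: the set of points whose orbit under `f` is unbounded. -/
def unboundedOrbitSet (f : ℂ → ℂ) : Set ℂ :=
  {z | ¬ Bornology.IsBounded (range fun n : ℕ => f^[n] z)}

/-- The minimum modulus `m(r) = min {|f(z)| : |z| = r}`. -/
noncomputable def minModulus (f : ℂ → ℂ) (r : ℝ) : ℝ :=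
  sInf ((fun z => ‖f z‖) '' Metric.sphere (0 : ℂ) r)

/-- For continuous `f` and `r ≥ 0` the infimum in `minModulus` is an attained minimum. -/
theorem isLeast_minModulus {f : ℂ → ℂ} (hf : Continuous f) {r : ℝ} (hr : 0 ≤ r) :
    IsLeast ((fun z => ‖f z‖) '' Metric.sphere (0 : ℂ) r) (minModulus f r) :=
  ((isCompact_sphere (0 : ℂ) r).image hf.norm).isLeast_sInf
    ((NormedSpace.sphere_nonempty.mpr hr).image _)

/-- `A` surrounds `B`: the set `B` lies in a bounded connected component of the complement
of `A`. -/
def Surrounds (A B : Set ℂ) : Prop :=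
  ∃ z ∈ Aᶜ, Bornology.IsBounded (connectedComponentIn Aᶜ z) ∧ B ⊆ connectedComponentIn Aᶜ z

/-- `(D n)` is a sequence of bounded, simply connected domains such that `f (∂ (D n))` surrounds
`D (n + 1)` for all `n ≥ 0`, and every disc centred at `0` lies in `D n` for all large `n`. -/
structure IsSurroundingSequence (f : ℂ → ℂ) (D : ℕ → Set ℂ) : Prop where
  isOpen : ∀ n, IsOpen (D n)
  isBounded : ∀ n, Bornology.IsBounded (D n)
  isSimplyConnected : ∀ n, IsSimplyConnected (D n)
  surrounds : ∀ n, Surrounds (f '' frontier (D n)) (D (n + 1))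
  eventually_ball_subset : ∀ R : ℝ, ∀ᶠ n in atTop, Metric.ball (0 : ℂ) R ⊆ D n

/-- The function `f(z) = -10 z e^{-z} - z / 2`. -/
noncomputable def exampleFun (z : ℂ) : ℂ := -10 * z * Complex.exp (-z) - z / 2

/-- The union of the rectangles `0 < Re z < 4nπ, |Im z| < 4nπ` and
`-nπ < Re z ≤ 0, |Im z| < nπ`. -/
def exampleDomain (n : ℕ) : Set ℂ :=
  {z | 0 < z.re ∧ z.re < 4 * n * Real.pi ∧ |z.im| < 4 * n * Real.pi} ∪
    {z | -(n * Real.pi) < z.re ∧ z.re ≤ 0 ∧ |z.im| < n * Real.pi}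

/-! Connectedness of `I⁺(f)` is the substantial claim. If it failed, disjoint open sets `U`, `V`
would contain the two pieces, and each component of `F = (U ∪ V)ᶜ` would be a closed connected set
of points with bounded orbits.

Such a set is compact and its orbits are uniformly bounded (`exists_subset_orbitBoundedBy`). The
engine is `image_iterate_subset_of_meets`: a connected image that meets `D N` without lying in it
hits `frontier (D N)`, so the next image has a point outside `D (N + 1)`, and so on; this is
impossible under a uniform bound. Without one, shrinking continua yield a point with unbounded
orbit.

The maximum principle for the iterates then puts every `u ∈ I⁺(f)` in an unbounded component of the
complement of each component of `F`, so `z - u` has a continuous logarithm near it. Gluing such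
logarithms (`not_separates_of_components`) shows that `F` cannot separate two points of `I⁺(f)`,
contradicting the choice of `U` and `V`.

For the concrete function, `f(∂D_n)` avoids `D_{n+1}` by one estimate on each type of boundary side,
and `m(r) ≤ |f(r)| ≤ r` for `r ≥ 5` prevents iterates of `m` from tending to infinity. -/

/-! ### Components of closed sets and boundary bumping. -/

/-- In a compact set, the component of a point can be separated from a disjoint closed set by a
relatively clopen set. -/
theorem exists_clopen_of_disjoint_connectedComponentIn {α : Type*} [TopologicalSpace α] [T2Space α]
    {X T : Set α} (hX : IsCompact X) {x : α} (hx : x ∈ X) (hT : IsClosed T)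
    (hd : Disjoint (connectedComponentIn X x) T) :
    ∃ Q ⊆ X, x ∈ Q ∧ IsClosed Q ∧ IsClosed (X \ Q) ∧ Disjoint Q T := by
  have : CompactSpace X := isCompact_iff_compactSpace.mp hX
  have hT' : IsCompact ((↑) ⁻¹' T : Set X) := (hT.preimage continuous_subtype_val).isCompact
  have hcc : ((↑) ⁻¹' T : Set X) ∩
      ⋂ s : {s : Set X // IsClopen s ∧ (⟨x, hx⟩ : X) ∈ s}, (s : Set X) = ∅ := by
    -- In a compact Hausdorff space components are quasicomponents; compactness of the trace of `T`
    -- then leaves finitely many clopen sets.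
    rw [← connectedComponent_eq_iInter_isClopen]
    ext y
    simp only [mem_inter_iff, mem_preimage, mem_empty_iff_false, iff_false, not_and]
    intro hyT hyc
    refine disjoint_left.mp hd ?_ hyT
    rw [connectedComponentIn_eq_image hx]
    exact mem_image_of_mem _ hyc
  obtain ⟨u, hu⟩ := hT'.elim_finite_subfamily_closed _ (fun s => s.2.1.1) hcc
  have hclopen : IsClopen
      (⋂ i ∈ u, (i : {s : Set X // IsClopen s ∧ (⟨x, hx⟩ : X) ∈ s}).1) :=
    isClopen_biInter_finset fun i _ => i.2.1
  refine ⟨(↑) '' (⋂ i ∈ u, (i : {s : Set X // IsClopen s ∧ (⟨x, hx⟩ : X) ∈ s}).1), ?_, ?_, ?_,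
    ?_, ?_⟩
  · rintro _ ⟨y, -, rfl⟩
    exact y.2
  · exact ⟨⟨x, hx⟩, mem_iInter₂.mpr fun i _ => i.2.2, rfl⟩
  · exact hX.isClosed.isClosedEmbedding_subtypeVal.isClosedMap _ hclopen.1
  · have := hX.isClosed.isClosedEmbedding_subtypeVal.isClosedMap _ hclopen.compl.1
    rwa [image_compl_eq_range_sdiff_image Subtype.val_injective, Subtype.range_coe] at this
  · rw [disjoint_left]
    rintro _ ⟨y, hy, rfl⟩ hyT
    have : y ∈ (∅ : Set X) := hu ▸ ⟨hyT, hy⟩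
    exact this

/-- A bounded component of a closed set has arbitrarily small compact relatively clopen
neighbourhoods. -/
theorem exists_compact_clopen_subset {α : Type*} [PseudoMetricSpace α] [T2Space α] [ProperSpace α]
    {F O : Set α} (hF : IsClosed F) {x : α} (hx : x ∈ F)
    (hb : Bornology.IsBounded (connectedComponentIn F x)) (hO : IsOpen O)
    (hsub : connectedComponentIn F x ⊆ O) :
    ∃ Q ⊆ F ∩ O, x ∈ Q ∧ IsCompact Q ∧ IsClosed (F \ Q) := by
  obtain ⟨r, hr⟩ := hb.subset_ball x
  have hxr : x ∈ Metric.ball x r := hr (mem_connectedComponentIn hx)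
  have hX : IsCompact (F ∩ Metric.closedBall x r) :=
    (isCompact_closedBall x r).inter_left hF
  obtain ⟨Q, hQX, hxQ, hQ, hXQ, hd⟩ := exists_clopen_of_disjoint_connectedComponentIn
    (T := (O ∩ Metric.ball x r)ᶜ) hX ⟨hx, Metric.ball_subset_closedBall hxr⟩
    (hO.inter Metric.isOpen_ball).isClosed_compl
    (disjoint_compl_right_iff_subset.mpr <|
      (connectedComponentIn_mono x inter_subset_left).trans (subset_inter hsub hr))
  rw [disjoint_compl_right_iff_subset] at hd
  refine ⟨Q, fun y hy => ⟨(hQX hy).1, (hd hy).1⟩, hxQ, hX.of_isClosed_subset hQ hQX, ?_⟩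
  -- `Q` stays in the open ball, so both pieces are closed and truncating `F` does no harm.
  have : F \ Q = (F ∩ Metric.closedBall x r) \ Q ∪ F ∩ (Metric.ball x r)ᶜ := by
    ext y
    have h1 := @hd y
    have h2 : y ∈ Metric.ball x r → y ∈ Metric.closedBall x r :=
      fun h => Metric.ball_subset_closedBall h
    simp only [Set.mem_sdiff, mem_inter_iff, mem_union, mem_compl_iff] at *
    tauto
  rw [this]
  exact hXQ.union (hF.inter Metric.isOpen_ball.isClosed_compl)

/-- A connected closed set that leaves a bounded open set `O` has components of its part in
`closure O` that reach the boundary of `O`. -/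
theorem not_connectedComponentIn_subset {α : Type*} [PseudoMetricSpace α] [T2Space α]
    [ProperSpace α] {A O : Set α} (hA : IsClosed A) (hc : IsPreconnected A) (hO : IsOpen O)
    (hb : Bornology.IsBounded O) {z : α} (hzA : z ∈ A) (hzO : z ∈ O) (hAO : ¬ A ⊆ O) :
    ¬ connectedComponentIn (A ∩ closure O) z ⊆ O := by
  intro hsub
  have hX : IsCompact (A ∩ closure O) := hb.isCompact_closure.inter_left hA
  obtain ⟨Q, hQX, hzQ, hQ, hXQ, hd⟩ := exists_clopen_of_disjoint_connectedComponentIn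
    hX ⟨hzA, subset_closure hzO⟩ hO.isClosed_compl (disjoint_compl_right_iff_subset.mpr hsub)
  rw [disjoint_compl_right_iff_subset] at hd
  obtain ⟨w, hwA, hwO⟩ := not_subset.mp hAO
  obtain ⟨y, -, hyQ, hy⟩ := isPreconnected_closed_iff.mp hc Q ((A ∩ closure O) \ Q ∪ A ∩ Oᶜ) hQ
    (hXQ.union (hA.inter hO.isClosed_compl))
    (fun y hy => by
      have h1 := @subset_closure _ _ O y
      simp only [Set.mem_sdiff, mem_inter_iff, mem_union, mem_compl_iff]
      tauto)
    ⟨z, hzA, hzQ⟩ ⟨w, hwA, Or.inr ⟨hwA, hwO⟩⟩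
  rcases hy with hy | hy
  · exact hy.2 hyQ
  · exact hy.2 (hd hyQ)

/-! ### Continuous logarithms and separation of the plane. -/

/-- The function `g` has a continuous logarithm in a neighbourhood of `A`. -/
def HasLogNear (A : Set ℂ) (g : ℂ → ℂ) : Prop :=
  ∃ O, IsOpen O ∧ A ⊆ O ∧ ∃ L : ℂ → ℂ, ContinuousOn L O ∧ ∀ z ∈ O, Complex.exp (L z) = g z

theorem HasLogNear.div {A : Set ℂ} {g h : ℂ → ℂ} (hg : HasLogNear A g) (hh : HasLogNear A h) :
    HasLogNear A fun z => g z / h z := by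
  obtain ⟨O, hO, hAO, L, hL, hLg⟩ := hg
  obtain ⟨O', hO', hAO', L', hL', hLh⟩ := hh
  refine ⟨O ∩ O', hO.inter hO', subset_inter hAO hAO', fun z => L z - L' z,
    (hL.mono inter_subset_left).sub (hL'.mono inter_subset_right), fun z hz => ?_⟩
  rw [Complex.exp_sub, hLg z hz.1, hLh z hz.2]

theorem HasLogNear.congr {A : Set ℂ} {g h : ℂ → ℂ} (hg : HasLogNear A g)
    {O : Set ℂ} (hO : IsOpen O) (hAO : A ⊆ O) (hgh : EqOn g h O) : HasLogNear A h := by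
  obtain ⟨O', hO', hAO', L, hL, hLg⟩ := hg
  exact ⟨O' ∩ O, hO'.inter hO, subset_inter hAO' hAO, L, hL.mono inter_subset_left,
    fun z hz => (hLg z hz.1).trans (hgh hz.2)⟩

theorem HasLogNear.of_norm_sub_one_lt {A : Set ℂ} {g : ℂ → ℂ} {O : Set ℂ} (hO : IsOpen O)
    (hAO : A ⊆ O) (hg : ContinuousOn g O) (h : ∀ z ∈ O, ‖g z - 1‖ < 1) : HasLogNear A g := by
  have hs : ∀ z ∈ O, g z ∈ Complex.slitPlane := fun z hz => by
    simpa using Complex.mem_slitPlane_of_norm_lt_one (h z hz)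
  exact ⟨O, hO, hAO, fun z => Complex.log (g z), hg.clog hs,
    fun z hz => Complex.exp_log (Complex.slitPlane_ne_zero (hs z hz))⟩

theorem hasLogNear_div_of_norm_sub_lt {A : Set ℂ} (x y : ℂ) (h : ∀ z ∈ A, ‖x - y‖ < ‖z - y‖) :
    HasLogNear A fun z => (z - x) / (z - y) := by
  have hne : ∀ z, ‖x - y‖ < ‖z - y‖ → z - y ≠ 0 := fun z hz =>
    norm_pos_iff.mp ((norm_nonneg _).trans_lt hz)
  refine HasLogNear.of_norm_sub_one_lt (O := {z | ‖x - y‖ < ‖z - y‖})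
    (isOpen_lt (by fun_prop) (by fun_prop)) h
    (ContinuousOn.div (by fun_prop) (by fun_prop) hne) fun z hz => ?_
  have : (z - x) / (z - y) - 1 = (y - x) / (z - y) := by
    field_simp [hne z hz]
    ring
  rw [this, norm_div, div_lt_one ((norm_nonneg _).trans_lt hz), norm_sub_rev]
  exact hz

/-- If `u` lies in an unbounded component of the complement of a compact set `A`, then `z - u` has
a continuous logarithm near `A`. -/
theorem hasLogNear_sub {A : Set ℂ} (hA : IsCompact A) {u : ℂ}
    (hub : ¬ Bornology.IsBounded (connectedComponentIn Aᶜ u)) : HasLogNear A fun z => z - u := by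
  obtain ⟨r, hr⟩ := hA.isBounded.subset_ball 0
  have huA : u ∈ Aᶜ := by
    by_contra h
    rw [connectedComponentIn_eq_empty h] at hub
    exact hub Bornology.isBounded_empty
  obtain ⟨w, hw, hwr⟩ : ∃ w ∈ connectedComponentIn Aᶜ u, w ∉ Metric.ball (0 : ℂ) (max r 1) :=
    not_subset.mp fun h => hub (Metric.isBounded_ball.subset h)
  have hw' : r ≤ ‖w‖ ∧ 1 ≤ ‖w‖ := by simpa using hwr
  have hw0 : w ≠ 0 := norm_pos_iff.mp (by linarith)
  have hcompl : ∀ x ∈ connectedComponentIn Aᶜ u, x ∈ Aᶜ := connectedComponentIn_subset _ _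
  have hP : HasLogNear A fun z => (z - u) / (z - w) := by
    -- `P` is symmetric, transitive and holds locally on the component, hence holds between any two
    -- of its points.
    let P : ℂ → ℂ → Prop := fun x y =>
      x ∈ Aᶜ ∧ y ∈ Aᶜ ∧ HasLogNear A fun z => (z - x) / (z - y)
    have hsymm : ∀ x y, P x y → P y x := fun x y ⟨hx, hy, h⟩ => by
      refine ⟨hy, hx, ?_⟩
      have h1 : HasLogNear A fun _ => (1 : ℂ) :=
        ⟨univ, isOpen_univ, subset_univ _, fun _ => 0, continuousOn_const, by simp⟩
      refine (h1.div h).congr isOpen_univ (subset_univ _) fun z _ => by simp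
    have htrans : ∀ x y z, P x y → P y z → P x z := fun x y z ⟨hx, hy, h⟩ ⟨_, hz, h'⟩ => by
      refine ⟨hx, hz, ?_⟩
      refine (h.div (hsymm _ _ ⟨hy, hz, h'⟩).2.2).congr
        (O := {y}ᶜ) isOpen_compl_singleton ?_ fun a ha => ?_
      · intro a ha hay
        exact hy (hay ▸ ha)
      · have : a - y ≠ 0 := sub_ne_zero.mpr ha
        simp only
        field_simp
    refine (isPreconnected_connectedComponentIn.induction₂ P (fun x hx => ?_)
      (fun x y z _ _ _ => htrans x y z) (fun x y _ _ => hsymm x y)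
      (mem_connectedComponentIn huA) hw : P u w).2.2
    have hxA := hcompl x hx
    obtain ⟨ε, hε, hεA⟩ := Metric.isOpen_iff.mp hA.isClosed.isOpen_compl x hxA
    filter_upwards [mem_nhdsWithin_of_mem_nhds (Metric.ball_mem_nhds x (half_pos hε)),
      self_mem_nhdsWithin] with y hy hyW
    refine ⟨hxA, hcompl y hyW, hasLogNear_div_of_norm_sub_lt _ _ fun z hz => ?_⟩
    rw [Metric.mem_ball, dist_comm, dist_eq_norm] at hy
    have h1 : ε ≤ ‖z - x‖ := by
      by_contra h
      exact hεA (mem_ball_iff_norm.mpr (not_le.mp h)) hz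
    have h2 := norm_sub_le_norm_sub_add_norm_sub z y x
    rw [norm_sub_rev y x] at h2
    linarith
  -- Write `1 / (z - w) = (-1 / w) / (1 - z / w)`; near `A` one has `|z / w| < 1`.
  have hQ : HasLogNear A fun z => 1 / (z - w) := by
    have h0 : HasLogNear A fun z => 1 - z / w := by
      refine HasLogNear.of_norm_sub_one_lt (O := Metric.ball 0 r) Metric.isOpen_ball hr
        (by fun_prop) fun z hz => ?_
      have : ‖z‖ < r := by simpa using hz
      rw [sub_sub_cancel_left, norm_neg, norm_div, div_lt_one (by linarith)]
      linarith
    have h1 : HasLogNear A fun _ => -1 / w := by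
      refine ⟨univ, isOpen_univ, subset_univ _, fun _ => Complex.log (-1 / w),
        continuousOn_const, fun z _ => Complex.exp_log ?_⟩
      exact div_ne_zero (by simp) hw0
    refine (h1.div h0).congr (O := {w}ᶜ) isOpen_compl_singleton ?_ fun z hz => ?_
    · intro a ha haw
      exact hcompl w hw (haw ▸ ha)
    · have h1 : z - w ≠ 0 := sub_ne_zero.mpr hz
      have h2 : w - z ≠ 0 := sub_ne_zero.mpr (Ne.symm hz)
      have h3 : 1 - z / w ≠ 0 := by
        rw [one_sub_div hw0]
        exact div_ne_zero h2 hw0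
      simp only
      rw [one_sub_div hw0]
      field_simp
      ring
  refine (hP.div hQ).congr (O := {w}ᶜ) isOpen_compl_singleton ?_ fun z hz => ?_
  · intro a ha haw
    exact hcompl w hw (haw ▸ ha)
  · have h1 : z - w ≠ 0 := sub_ne_zero.mpr hz
    simp only
    field_simp

/-- There is no continuous logarithm of `1 / (z - u)` near infinity. -/
theorem not_exists_log_near_infty {ℓ : ℂ → ℂ} (hℓ : Continuous ℓ) (u : ℂ) (R : ℝ)
    (h : ∀ z, R ≤ ‖z‖ → Complex.exp (ℓ z) = 1 / (z - u)) : False := by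
  set r : ℝ := |R| + ‖u‖ + 1 with hr
  have hrpos : 0 < r := by positivity
  -- On a circle about `u` outside radius `R`, `ψ` lifts the constant `1 / r` through `exp`, so it
  -- is constant; yet it increases by `2πi` over one turn.
  let ψ : ℝ → ℂ := fun θ => ℓ (u + r * Complex.exp (θ * Complex.I)) + θ * Complex.I
  have hψ : Continuous ψ := by fun_prop
  have hexp : ∀ θ, Complex.exp (ψ θ) = 1 / r := fun θ => by
    have hn : R ≤ ‖u + r * Complex.exp (θ * Complex.I)‖ := by
      have h1 : ‖(r : ℂ) * Complex.exp (θ * Complex.I)‖ = r := by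
        rw [norm_mul, Complex.norm_exp_ofReal_mul_I, mul_one, Complex.norm_real,
          Real.norm_of_nonneg hrpos.le]
      have h2 := norm_sub_le (u + r * Complex.exp (θ * Complex.I)) u
      rw [add_sub_cancel_left, h1] at h2
      have := le_abs_self R
      linarith
    simp only [ψ]
    have hr0 : (r : ℂ) ≠ 0 := by exact_mod_cast hrpos.ne'
    rw [Complex.exp_add, h _ hn, add_sub_cancel_left]
    field_simp [Complex.exp_ne_zero]
  have hconst : ψ = fun _ => ψ 0 := by
    refine Complex.isCoveringMap_exp.eq_of_comp_eq hψ continuous_const ?_ 0 rfl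
    ext θ
    simp [hexp]
  have := congrFun hconst (2 * Real.pi)
  simp only [ψ] at this
  push_cast at this
  rw [Complex.exp_two_pi_mul_I] at this
  simp [Complex.I_ne_zero, Real.pi_ne_zero] at this

/-- If `(z - u) / (z - v)` has a continuous logarithm near each component of a closed set `F`, and
all these components are bounded, then `F` does not separate `u` from `v`. -/
theorem not_separates_of_components {U V : Set ℂ} (hU : IsOpen U) (hV : IsOpen V)
    (hUV : Disjoint U V) {u v : ℂ} (hu : u ∈ U) (hv : v ∈ V)
    (hb : ∀ x ∈ (U ∪ V)ᶜ, Bornology.IsBounded (connectedComponentIn (U ∪ V)ᶜ x))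
    (hlog : ∀ x ∈ (U ∪ V)ᶜ,
      HasLogNear (connectedComponentIn (U ∪ V)ᶜ x) fun z => (z - u) / (z - v)) : False := by
  classical
  set F : Set ℂ := (U ∪ V)ᶜ with hFdef
  have hF : IsClosed F := (hU.union hV).isClosed_compl
  set g : ℂ → ℂ := fun z => (z - u) / (z - v) with hg
  -- Beyond this radius `|g - 1| < 1`, so the principal logarithm of `g` is available there.
  set R : ℝ := ‖v‖ + ‖u - v‖ + 1 with hR
  have hfar : ∀ z, R ≤ ‖z‖ → ‖u - v‖ < ‖z - v‖ := fun z hz => by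
    have := norm_sub_norm_le z v
    linarith
  -- Compactness needs only finitely many local logarithms. Their domains are relatively clopen in
  -- `F`, so overlaps can be discarded and no compatibility is needed.
  obtain ⟨Q, hSQ, hQF, hQ, hFQ, L, hL, hLg⟩ : ∃ Q, F ∩ Metric.closedBall 0 R ⊆ Q ∧ Q ⊆ F ∧
      IsCompact Q ∧ IsClosed (F \ Q) ∧
      ∃ L : ℂ → ℂ, ContinuousOn L Q ∧ ∀ z ∈ Q, Complex.exp (L z) = g z := by
    refine ((isCompact_closedBall (0 : ℂ) R).inter_left hF).induction_on
      (p := fun S => ∃ Q, S ⊆ Q ∧ Q ⊆ F ∧ IsCompact Q ∧ IsClosed (F \ Q) ∧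
        ∃ L : ℂ → ℂ, ContinuousOn L Q ∧ ∀ z ∈ Q, Complex.exp (L z) = g z) ?_ ?_ ?_ ?_
    · exact ⟨∅, Subset.rfl, empty_subset _, isCompact_empty, by simpa using hF, fun _ => 0,
        continuousOn_empty _, by simp⟩
    · rintro s t hst ⟨Q, h, h'⟩
      exact ⟨Q, hst.trans h, h'⟩
    · rintro s t ⟨Q₁, hs, hQF₁, hQ₁, hFQ₁, L₁, hL₁, hLg₁⟩ ⟨Q₂, ht, hQF₂, hQ₂, hFQ₂, L₂, hL₂, hLg₂⟩
      have hun : Q₁ ∪ Q₂ = Q₁ ∪ Q₂ ∩ (F \ Q₁) := by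
        ext z
        have := @hQF₂ z
        simp only [mem_union, mem_inter_iff, Set.mem_sdiff]
        tauto
      refine ⟨Q₁ ∪ Q₂, union_subset_union hs ht, union_subset hQF₁ hQF₂, hQ₁.union hQ₂, ?_,
        Q₁.piecewise L₁ L₂, ?_, fun z hz => ?_⟩
      · rw [← sdiff_inter_sdiff]
        exact hFQ₁.inter hFQ₂
      · rw [hun]
        refine ContinuousOn.union_of_isClosed ?_ ?_ hQ₁.isClosed (hQ₂.isClosed.inter hFQ₁)
        · exact hL₁.congr fun z hz => piecewise_eq_of_mem _ _ _ hz
        · exact (hL₂.mono inter_subset_left).congr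
            fun z hz => piecewise_eq_of_notMem _ _ _ hz.2.2
      · by_cases h1 : z ∈ Q₁
        · rw [piecewise_eq_of_mem _ _ _ h1, hLg₁ z h1]
        · rw [piecewise_eq_of_notMem _ _ _ h1, hLg₂ z (hz.resolve_left h1)]
    · rintro x ⟨hxF, -⟩
      obtain ⟨O, hO, hAO, L, hL, hLg⟩ := hlog x hxF
      obtain ⟨Q, hQFO, hxQ, hQ, hFQ⟩ := exists_compact_clopen_subset hF hxF (hb x hxF) hO hAO
      refine ⟨Q, ?_, Q, Subset.rfl, fun z hz => (hQFO hz).1, hQ, hFQ, L,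
        hL.mono fun z hz => (hQFO hz).2, fun z hz => hLg z (hQFO hz).2⟩
      filter_upwards [self_mem_nhdsWithin,
        mem_nhdsWithin_of_mem_nhds (hFQ.isOpen_compl.mem_nhds fun h => h.2 hxQ)] with y hy hy'
      by_contra h
      exact hy' ⟨hy.1, h⟩
  obtain ⟨r, hr⟩ := hQ.isBounded.subset_ball 0
  -- Adding a neighbourhood of infinity forces `exp G = g` there for the Tietze extension `G`, even
  -- off `F`.
  set E : Set ℂ := F \ Q ∪ {z | max r R ≤ ‖z‖} with hE
  have hEcl : IsClosed E := hFQ.union (isClosed_le continuous_const continuous_norm)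
  have hEfar : ∀ z ∈ E, R ≤ ‖z‖ := by
    rintro z (hz | hz)
    · by_contra h
      exact hz.2 (hSQ ⟨hz.1, by simpa using (not_le.mp h).le⟩)
    · exact (le_max_right _ _).trans hz
  have hEQ : ∀ z ∈ E, z ∉ Q := by
    rintro z (hz | hz) hzQ
    · exact hz.2 hzQ
    · have h1 : ‖z‖ < r := by simpa using hr hzQ
      exact absurd ((le_max_left r R).trans hz) (not_le.mpr h1)
  have hEslit : ∀ z ∈ E, z - v ≠ 0 ∧ g z ∈ Complex.slitPlane := fun z hz => by
    have h1 := hfar z (hEfar z hz)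
    have hne : z - v ≠ 0 := norm_pos_iff.mp ((norm_nonneg _).trans_lt h1)
    refine ⟨hne, ?_⟩
    have h2 : g z = 1 + (v - u) / (z - v) := by
      simp only [hg]
      field_simp
      ring
    rw [h2]
    apply Complex.mem_slitPlane_of_norm_lt_one
    rw [norm_div, div_lt_one ((norm_nonneg _).trans_lt h1), norm_sub_rev]
    exact h1
  have hL₀ : ContinuousOn (Q.piecewise L fun z => Complex.log (g z)) (Q ∪ E) := by
    refine ContinuousOn.union_of_isClosed ?_ ?_ hQ.isClosed hEcl
    · exact hL.congr fun z hz => piecewise_eq_of_mem _ _ _ hz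
    · refine ContinuousOn.congr (f := fun z => Complex.log (g z)) ?_
        fun z hz => piecewise_eq_of_notMem _ _ _ (hEQ z hz)
      exact ContinuousOn.clog (ContinuousOn.div (by fun_prop) (by fun_prop)
        fun z hz => (hEslit z hz).1) fun z hz => (hEslit z hz).2
  obtain ⟨G, hG⟩ := ContinuousMap.exists_restrict_eq (hQ.isClosed.union hEcl)
    ⟨(Q ∪ E).domRestrict (Q.piecewise L fun z => Complex.log (g z)),
      continuousOn_iff_continuous_domRestrict.mp hL₀⟩
  have hGg : ∀ z ∈ Q ∪ E, Complex.exp (G z) = g z := fun z hz => by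
    have h1 : G z = Q.piecewise L (fun z => Complex.log (g z)) z :=
      DFunLike.congr_fun hG ⟨z, hz⟩
    rw [h1]
    by_cases h2 : z ∈ Q
    · rw [piecewise_eq_of_mem _ _ _ h2, hLg z h2]
    · rw [piecewise_eq_of_notMem _ _ _ h2,
        Complex.exp_log (Complex.slitPlane_ne_zero (hEslit z (hz.resolve_left h2)).2)]
  have hkey : ∀ z ∈ Q ∪ E, Complex.exp (-G z) / (z - v) = 1 / (z - u) := fun z hz => by
    have h1 := hGg z hz
    have h2 : g z ≠ 0 := h1 ▸ Complex.exp_ne_zero _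
    have h3 : z - v ≠ 0 := fun h => h2 (by simp [hg, h])
    have h4 : z - u ≠ 0 := fun h => h2 (by simp [hg, h])
    rw [Complex.exp_neg, h1]
    simp only [hg]
    field_simp
  have hFQE : F ⊆ Q ∪ E := fun z hz => by
    by_cases h : z ∈ Q
    · exact Or.inl h
    · exact Or.inr (Or.inl ⟨hz, h⟩)
  have hvU : v ∉ U := fun h => disjoint_left.mp hUV h hv
  -- The two formulas agree on `F`, and each is used away from its pole, so `k` is continuous and
  -- zero-free on the plane. Its global logarithm would be one of `1 / (z - u)` near infinity.
  let k : ℂ → ℂ := U.piecewise (fun z => Complex.exp (-G z) / (z - v)) fun z => 1 / (z - u)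
  have hkU : ∀ z ∈ Uᶜ, k z = 1 / (z - u) := fun z hz => piecewise_eq_of_notMem _ _ _ hz
  have hkV : ∀ z ∈ Vᶜ, k z = Complex.exp (-G z) / (z - v) := fun z hz => by
    by_cases h : z ∈ U
    · exact piecewise_eq_of_mem _ _ _ h
    · rw [hkU z h, hkey z (hFQE fun h' => h'.elim h hz)]
  have hun : Uᶜ ∪ Vᶜ = univ := by
    rw [← compl_inter, hUV.inter_eq, compl_empty]
  have hkc : Continuous k := by
    rw [← continuousOn_univ, ← hun]
    refine ContinuousOn.union_of_isClosed ?_ ?_ hU.isClosed_compl hV.isClosed_compl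
    · refine ContinuousOn.congr (ContinuousOn.div (by fun_prop) (by fun_prop) ?_) hkU
      exact fun z hz h => hz (sub_eq_zero.mp h ▸ hu)
    · refine ContinuousOn.congr (ContinuousOn.div (by fun_prop) (by fun_prop) ?_) hkV
      exact fun z hz h => hz (sub_eq_zero.mp h ▸ hv)
  have hk0 : ∀ z, k z ≠ 0 := fun z => by
    by_cases h : z ∈ U
    · rw [hkV z (disjoint_left.mp hUV h)]
      exact div_ne_zero (Complex.exp_ne_zero _) fun h' => hvU (sub_eq_zero.mp h' ▸ h)
    · rw [hkU z h]
      exact div_ne_zero one_ne_zero fun h' => h (sub_eq_zero.mp h' ▸ hu)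
  have hsc : IsSimplyConnected (univ : Set ℂ) := by
    have : ContractibleSpace (univ : Set ℂ) := convex_univ.contractibleSpace univ_nonempty
    exact (inferInstance : SimplyConnectedSpace (univ : Set ℂ))
  obtain ⟨ℓ, hℓ, hℓk⟩ := Complex.exists_continuousOn_eqOn_exp_comp hsc isOpen_univ
    hkc.continuousOn (by rintro ⟨z, -, hz⟩; exact hk0 z hz)
  refine not_exists_log_near_infty (continuousOn_univ.mp hℓ) u (max r R) fun z hz => ?_
  have h1 : Complex.exp (ℓ z) = k z := hℓk (mem_univ z)
  rw [h1]
  by_cases h : z ∈ U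
  · rw [hkV z (disjoint_left.mp hUV h), hkey z (Or.inr (Or.inr hz))]
  · exact hkU z h

/-! ### Uniform boundedness of orbits on closed connected sets. -/

theorem notMem_unboundedOrbitSet_iff {f : ℂ → ℂ} {z : ℂ} :
    z ∉ unboundedOrbitSet f ↔ ∃ R : ℝ, ∀ l, ‖f^[l] z‖ ≤ R := by
  simp only [unboundedOrbitSet, mem_ofPred_eq, not_not, isBounded_iff_forall_norm_le,
    forall_mem_range]

/-- The set of points whose orbit stays in the closed disc of radius `R`. -/
def orbitBoundedBy (f : ℂ → ℂ) (R : ℝ) : Set ℂ :=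
  {z | ∀ l : ℕ, ‖f^[l] z‖ ≤ R}

theorem isClosed_orbitBoundedBy {f : ℂ → ℂ} (hf : Continuous f) (R : ℝ) :
    IsClosed (orbitBoundedBy f R) := by
  simp only [orbitBoundedBy, ofPred_forall]
  exact isClosed_iInter fun l => isClosed_le (hf.iterate l).norm continuous_const

/-- Points of a connected set whose orbits are uniformly bounded cannot cross the boundary of
`D N` if at all times some points of the set are in the later domains. -/
theorem image_iterate_subset_of_meets {f : ℂ → ℂ} (hf : Continuous f) {D : ℕ → Set ℂ}
    (hopen : ∀ n, IsOpen (D n)) (hball : ∀ R : ℝ, ∀ᶠ n in atTop, Metric.ball (0 : ℂ) R ⊆ D n)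
    (hsur : ∀ n, ∀ z ∈ frontier (D n), f z ∉ D (n + 1)) {S : Set ℂ} (hS : IsPreconnected S)
    {R : ℝ} (hSR : S ⊆ orbitBoundedBy f R) {N : ℕ}
    (hmeet : ∀ m ≥ N, ∀ l, ∃ z ∈ S, f^[l] z ∈ D m) (l : ℕ) {z : ℂ} (hz : z ∈ S) :
    f^[l] z ∈ D N := by
  by_contra hout
  -- An escape from `D N` propagates to `D (N + i)`, which eventually contains the disc of radius `R
  -- + 1`.
  have key : ∀ i, ∃ w ∈ S, f^[l + i] w ∉ D (N + i) := by
    intro i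
    induction i with
    | zero => exact ⟨z, hz, hout⟩
    | succ i ih =>
      obtain ⟨w, hw, hwD⟩ := ih
      obtain ⟨x, hx, hxD⟩ := hmeet (N + i) (Nat.le_add_right _ _) (l + i)
      by_contra! hcon
      have hfr : ∀ y ∈ S, f^[l + i] y ∉ frontier (D (N + i)) := fun y hy hyf => by
        refine hsur _ _ hyf ?_
        rw [← Function.iterate_succ_apply' f (l + i) y]
        exact hcon y hy
      have himg : IsPreconnected (f^[l + i] '' S) := hS.image _ (hf.iterate _).continuousOn
      have hsub : f^[l + i] '' S ⊆ D (N + i) := by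
        refine himg.subset_left_of_subset_union (hopen _) (isClosed_closure (s := D (N + i))).isOpen_compl
          (disjoint_compl_right.mono_left subset_closure) ?_ ⟨_, mem_image_of_mem _ hx, hxD⟩
        rintro _ ⟨y, hy, rfl⟩
        by_contra h
        rw [mem_union, mem_compl_iff, not_or, not_not] at h
        refine hfr y hy ?_
        rw [(hopen _).frontier_eq]
        exact ⟨h.2, h.1⟩
      exact hwD (hsub (mem_image_of_mem _ hw))
  obtain ⟨M, hM⟩ := eventually_atTop.mp (hball (R + 1))
  obtain ⟨w, hw, hwD⟩ := key M
  refine hwD (hM (N + M) (Nat.le_add_left _ _) ?_)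
  rw [mem_ball_zero_iff]
  linarith [hSR hw (l + M)]

/-- A continuum of points with bounded orbits, on which the orbits are not uniformly bounded,
contains such a continuum some iterate of which is far from the origin. -/
theorem exists_subcontinuum_far {f : ℂ → ℂ} (hf : Continuous f) {D : ℕ → Set ℂ}
    (hopen : ∀ n, IsOpen (D n)) (hbdd : ∀ n, Bornology.IsBounded (D n))
    (hball : ∀ R : ℝ, ∀ᶠ n in atTop, Metric.ball (0 : ℂ) R ⊆ D n)
    (hsur : ∀ n, ∀ z ∈ frontier (D n), f z ∉ D (n + 1)) {C : Set ℂ} (hC : IsCompact C)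
    (hCc : IsPreconnected C) (hCK : ∀ z ∈ C, z ∉ unboundedOrbitSet f)
    (hCU : ∀ R, ¬ C ⊆ orbitBoundedBy f R) (ρ : ℝ) :
    ∃ C' ⊆ C, IsCompact C' ∧ IsPreconnected C' ∧ (∀ R, ¬ C' ⊆ orbitBoundedBy f R) ∧
      ∃ k, ∀ z ∈ C', ρ < ‖f^[k] z‖ := by
  by_contra! hcon
  obtain ⟨N₀, hN₀⟩ := eventually_atTop.mp (hball (ρ + 1))
  obtain ⟨R₀, hR₀⟩ := isBounded_iff_forall_norm_le.mp (hbdd N₀)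
  -- If every non-uniform subcontinuum keeps returning to the disc of radius `ρ`, then `R₀`, which
  -- depends only on `ρ`, bounds every orbit from `C`.
  refine hCU R₀ fun t ht => ?_
  obtain ⟨r, hr⟩ := notMem_unboundedOrbitSet_iff.mp (hCK t ht)
  obtain ⟨N, hN⟩ := eventually_atTop.mp (hball (r + 1))
  obtain ⟨R, hR⟩ := isBounded_iff_forall_norm_le.mp (hbdd N)
  have htD : ∀ m ≥ N, ∀ l, f^[l] t ∈ D m := fun m hm l => hN m hm (by
    rw [mem_ball_zero_iff]
    linarith [hr l])
  set X : Set ℂ := C ∩ orbitBoundedBy f R with hX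
  have htX : t ∈ X := ⟨ht, fun l => hR _ (htD N le_rfl l)⟩
  set M : Set ℂ := connectedComponentIn X t with hM
  have htM : t ∈ M := mem_connectedComponentIn htX
  have hMX : M ⊆ X := connectedComponentIn_subset _ _
  have hXcl : IsCompact X := hC.inter_right (isClosed_orbitBoundedBy hf R)
  have hMcpt : IsCompact M := by
    refine hXcl.of_isClosed_subset ?_ hMX
    refine isClosed_of_closure_subset ?_
    exact isPreconnected_connectedComponentIn.closure.subset_connectedComponentIn
      (subset_closure htM) (closure_minimal hMX hXcl.isClosed)
  -- Otherwise `M` has a neighbourhood on which `f^[k]` stays outside the disc. The component `C'`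
  -- of `C` there containing `t` must have uniform bounds, which the crossing lemma improves to `R`;
  -- so `C' ⊆ M`, against boundary bumping.
  have hnear : ∀ k, ∃ z ∈ M, ‖f^[k] z‖ ≤ ρ := by
    intro k
    by_contra! hk
    obtain ⟨c, hcC, hcR⟩ := not_subset.mp (hCU R)
    have hcM : c ∉ M := fun h => hcR (hMX h).2
    obtain ⟨B, hBc, hMB, hBO⟩ := exists_compact_between hMcpt
      ((isOpen_lt continuous_const (hf.iterate k).norm).inter
        -- Removing `c` ensures that `C` leaves the neighbourhood.
        (isOpen_compl_singleton (x := c)))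
      (fun z hz => ⟨hk z hz, fun h : z = c => hcM (h ▸ hz)⟩ :
        M ⊆ {z | ρ < ‖f^[k] z‖} ∩ {c}ᶜ)
    have hclB : closure (interior B) ⊆ B := closure_minimal interior_subset hBc.isClosed
    set C' : Set ℂ := connectedComponentIn (C ∩ closure (interior B)) t with hC'
    have htC' : t ∈ C' := mem_connectedComponentIn ⟨ht, subset_closure (hMB htM)⟩
    have hC'C : C' ⊆ C ∩ closure (interior B) := connectedComponentIn_subset _ _
    have hcpt : IsCompact (C ∩ closure (interior B)) := hC.inter_right isClosed_closure
    have hC'c : IsPreconnected C' := isPreconnected_connectedComponentIn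
    have hC'cpt : IsCompact C' := by
      refine hcpt.of_isClosed_subset (isClosed_of_closure_subset ?_) hC'C
      exact hC'c.closure.subset_connectedComponentIn
        (subset_closure htC') (closure_minimal hC'C hcpt.isClosed)
    obtain ⟨z, hz, hzk⟩ := hcon C' (fun z hz => (hC'C hz).1) hC'cpt hC'c (fun R' hR' => by
      refine not_connectedComponentIn_subset hC.isClosed hCc isOpen_interior
        (hBc.isBounded.subset interior_subset) ht (hMB htM)
        (fun h => (hBO (interior_subset (h hcC))).2 rfl) ?_
      refine Subset.trans ?_ hMB
      refine hC'c.subset_connectedComponentIn htC' fun y hy => ⟨(hC'C hy).1, fun l => ?_⟩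
      exact hR _ (image_iterate_subset_of_meets hf hopen hball hsur hC'c hR'
        (fun m hm l => ⟨t, htC', htD m hm l⟩) l hy)) k
    exact absurd (hBO (hclB (hC'C hz).2)).1 (not_lt.mpr hzk)
  intro l
  refine hR₀ _ (image_iterate_subset_of_meets hf hopen hball hsur
    (S := M) isPreconnected_connectedComponentIn (fun z hz => (hMX hz).2)
    (fun m hm l => ?_) l htM)
  obtain ⟨z, hz, hzl⟩ := hnear l
  exact ⟨z, hz, hN₀ m hm (by rw [mem_ball_zero_iff]; linarith)⟩

/-- On a continuum of points with bounded orbits the orbits are uniformly bounded. -/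
theorem exists_subset_orbitBoundedBy_of_isCompact {f : ℂ → ℂ} (hf : Continuous f) {D : ℕ → Set ℂ}
    (hopen : ∀ n, IsOpen (D n)) (hbdd : ∀ n, Bornology.IsBounded (D n))
    (hball : ∀ R : ℝ, ∀ᶠ n in atTop, Metric.ball (0 : ℂ) R ⊆ D n)
    (hsur : ∀ n, ∀ z ∈ frontier (D n), f z ∉ D (n + 1)) {C : Set ℂ} (hC : IsCompact C)
    (hCc : IsPreconnected C) (hCK : ∀ z ∈ C, z ∉ unboundedOrbitSet f) :
    ∃ R, C ⊆ orbitBoundedBy f R := by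
  by_contra! hCU
  let 𝒞 := {B : Set ℂ // B ⊆ C ∧ IsCompact B ∧ IsPreconnected B ∧
    ∀ R, ¬ B ⊆ orbitBoundedBy f R}
  have step : ∀ (n : ℕ) (B : 𝒞), ∃ B' : 𝒞, B'.1 ⊆ B.1 ∧
      ∃ k, ∀ z ∈ B'.1, (n : ℝ) < ‖f^[k] z‖ := by
    rintro n ⟨B, hBC, hB, hBc, hBU⟩
    obtain ⟨B', hB'B, hB', hB'c, hB'U, hk⟩ := exists_subcontinuum_far hf hopen hbdd hball hsur hB
      hBc (fun z hz => hCK z (hBC hz)) hBU n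
    exact ⟨⟨B', hB'B.trans hBC, hB', hB'c, hB'U⟩, hB'B, hk⟩
  choose next hnext hfar using step
  let B : ℕ → 𝒞 := Nat.rec ⟨C, Subset.rfl, hC, hCc, hCU⟩ next
  -- A point common to the nested continua exceeds norm `n` at some time for each `n`.
  obtain ⟨z, hz⟩ := IsCompact.nonempty_iInter_of_sequence_nonempty_isCompact_isClosed
    (fun n => (B n).1) (fun n => hnext n (B n))
    (fun n => nonempty_iff_ne_empty.mpr fun h => (B n).2.2.2.2 0 (h ▸ empty_subset _))
    (B 0).2.2.1 (fun n => (B n).2.2.1.isClosed)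
  rw [mem_iInter] at hz
  obtain ⟨R, hR⟩ := notMem_unboundedOrbitSet_iff.mp (hCK z (hz 0))
  obtain ⟨n, hn⟩ := exists_nat_gt R
  obtain ⟨k, hk⟩ := hfar n (B n)
  linarith [hk z (hz (n + 1)), hR k]

/-- A closed connected set of points with bounded orbits is bounded, with uniformly bounded
orbits. -/
theorem exists_subset_orbitBoundedBy {f : ℂ → ℂ} (hf : Continuous f) {D : ℕ → Set ℂ}
    (hopen : ∀ n, IsOpen (D n)) (hbdd : ∀ n, Bornology.IsBounded (D n))
    (hball : ∀ R : ℝ, ∀ᶠ n in atTop, Metric.ball (0 : ℂ) R ⊆ D n)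
    (hsur : ∀ n, ∀ z ∈ frontier (D n), f z ∉ D (n + 1)) {A : Set ℂ} (hA : IsClosed A)
    (hAc : IsPreconnected A) (hAK : ∀ z ∈ A, z ∉ unboundedOrbitSet f) :
    IsCompact A ∧ ∃ R, A ⊆ orbitBoundedBy f R := by
  rcases A.eq_empty_or_nonempty with rfl | ⟨z, hz⟩
  · exact ⟨isCompact_empty, 0, empty_subset _⟩
  suffices hb : Bornology.IsBounded A by
    have hcpt := Metric.isCompact_of_isClosed_isBounded hA hb
    exact ⟨hcpt, exists_subset_orbitBoundedBy_of_isCompact hf hopen hbdd hball hsur hcpt hAc hAK⟩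
  obtain ⟨r, hr⟩ := notMem_unboundedOrbitSet_iff.mp (hAK z hz)
  obtain ⟨N, hN⟩ := eventually_atTop.mp (hball (r + 1))
  have hzD : ∀ m ≥ N, ∀ l, f^[l] z ∈ D m := fun m hm l => hN m hm (by
    rw [mem_ball_zero_iff]
    linarith [hr l])
  refine (hbdd N).subset ?_
  by_contra hAD
  refine not_connectedComponentIn_subset hA hAc (hopen N) (hbdd N) hz (hzD N le_rfl 0) hAD ?_
  set C : Set ℂ := connectedComponentIn (A ∩ closure (D N)) z with hC
  have hzC : z ∈ C := mem_connectedComponentIn ⟨hz, subset_closure (hzD N le_rfl 0)⟩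
  have hCA : C ⊆ A ∩ closure (D N) := connectedComponentIn_subset _ _
  have hcpt : IsCompact (A ∩ closure (D N)) := (hbdd N).isCompact_closure.inter_left hA
  have hCc : IsPreconnected C := isPreconnected_connectedComponentIn
  have hCcpt : IsCompact C := by
    refine hcpt.of_isClosed_subset (isClosed_of_closure_subset ?_) hCA
    exact hCc.closure.subset_connectedComponentIn
      (subset_closure hzC) (closure_minimal hCA hcpt.isClosed)
  obtain ⟨R, hR⟩ := exists_subset_orbitBoundedBy_of_isCompact hf hopen hbdd hball hsur hCcpt hCc
    fun y hy => hAK y (hCA hy).1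
  exact fun y hy => image_iterate_subset_of_meets hf hopen hball hsur hCc hR
    (fun m hm l => ⟨z, hzC, hzD m hm l⟩) 0 hy

/-! ### Connectedness of the set of unbounded orbits. -/

/-- If the orbits of the points of `A` are uniformly bounded, then every point with unbounded orbit
lies in an unbounded component of the complement of `A`. -/
theorem not_isBounded_connectedComponentIn_compl {f : ℂ → ℂ} (hf : Differentiable ℂ f) {A : Set ℂ}
    (hA : IsClosed A) {R : ℝ} (hAR : A ⊆ orbitBoundedBy f R) {u : ℂ}
    (hu : u ∈ unboundedOrbitSet f) :
    ¬ Bornology.IsBounded (connectedComponentIn Aᶜ u) := by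
  intro hb
  refine notMem_unboundedOrbitSet_iff.mpr ⟨R, fun l => ?_⟩ hu
  have huA : u ∈ Aᶜ := fun h => notMem_unboundedOrbitSet_iff.mpr ⟨R, hAR h⟩ hu
  have hopen : IsOpen (connectedComponentIn Aᶜ u) := hA.isOpen_compl.connectedComponentIn
  refine Complex.norm_le_of_forall_mem_frontier_norm_le hb
    (Differentiable.diffContOnCl (hf.iterate l)) (fun z hz => ?_)
    (subset_closure (mem_connectedComponentIn huA))
  -- The frontier of a component of the open set `Aᶜ` lies in `A`, where every iterate is bounded by
  -- `R`.
  suffices hzA : z ∈ A from hAR hzA l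
  by_contra hzA
  rw [hopen.frontier_eq] at hz
  obtain ⟨y, hy, hyu⟩ := mem_closure_iff.mp hz.1 (connectedComponentIn Aᶜ z)
    hA.isOpen_compl.connectedComponentIn (mem_connectedComponentIn hzA)
  refine hz.2 ?_
  rw [connectedComponentIn_eq hyu, ← connectedComponentIn_eq hy]
  exact mem_connectedComponentIn hzA

/-- The set of points with unbounded orbit is connected if there is a sequence of bounded open sets
exhausting the plane such that `f` maps the boundary of each outside of the next one. -/
theorem isConnected_unboundedOrbitSet {f : ℂ → ℂ} (hf : Differentiable ℂ f) {D : ℕ → Set ℂ}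
    (hopen : ∀ n, IsOpen (D n)) (hbdd : ∀ n, Bornology.IsBounded (D n))
    (hball : ∀ R : ℝ, ∀ᶠ n in atTop, Metric.ball (0 : ℂ) R ⊆ D n)
    (hsur : ∀ n, ∀ z ∈ frontier (D n), f z ∉ D (n + 1)) :
    IsConnected (unboundedOrbitSet f) := by
  constructor
  · by_contra! h
    have := (exists_subset_orbitBoundedBy hf.continuous hopen hbdd hball hsur isClosed_univ
      isPreconnected_univ (by simp [h])).1
    exact noncompact_univ ℂ this
  · intro U₀ V₀ hU₀ hV₀ hcov ⟨u, hu, huU⟩ ⟨v, hv, hvV⟩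
    by_contra hne
    set I := unboundedOrbitSet f with hI
    have hne' : ∀ z ∈ I, z ∈ U₀ → z ∉ V₀ := fun z hz h1 h2 => hne ⟨z, hz, h1, h2⟩
    -- `U₀` and `V₀` may meet outside `I`; complete normality supplies disjoint neighbourhoods.
    obtain ⟨U, V, hU, hV, hIU, hIV, hUV⟩ : SeparatedNhds (I ∩ U₀) (I ∩ V₀) := by
      rw [separatedNhds_iff_disjoint]
      refine CompletelyNormalSpace.completely_normal ?_ ?_
      · rw [disjoint_left]
        intro z hz hz'
        obtain ⟨y, hyV, hyI, hyU⟩ := mem_closure_iff.mp hz V₀ hV₀ hz'.2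
        exact hne' y hyI hyU hyV
      · rw [disjoint_left]
        intro z hz' hz
        obtain ⟨y, hyU, hyI, hyV⟩ := mem_closure_iff.mp hz U₀ hU₀ hz'.2
        exact hne' y hyI hyU hyV
    have hcomp : ∀ x ∈ (U ∪ V)ᶜ, IsCompact (connectedComponentIn (U ∪ V)ᶜ x) ∧
        ∃ R, connectedComponentIn (U ∪ V)ᶜ x ⊆ orbitBoundedBy f R := fun x hx => by
      have hcl : IsClosed (U ∪ V)ᶜ := (hU.union hV).isClosed_compl
      refine exists_subset_orbitBoundedBy hf.continuous hopen hbdd hball hsur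
        (isClosed_of_closure_subset ?_) isPreconnected_connectedComponentIn fun z hz hzI => ?_
      · exact isPreconnected_connectedComponentIn.closure.subset_connectedComponentIn
          (subset_closure (mem_connectedComponentIn hx))
          (closure_minimal (connectedComponentIn_subset _ _) hcl)
      · refine connectedComponentIn_subset _ _ hz ?_
        exact (hcov hzI).imp (fun h => hIU ⟨hzI, h⟩) fun h => hIV ⟨hzI, h⟩
    refine not_separates_of_components hU hV hUV (hIU ⟨hu, huU⟩) (hIV ⟨hv, hvV⟩)
      (fun x hx => (hcomp x hx).1.isBounded) fun x hx => ?_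
    obtain ⟨hcpt, R, hR⟩ := hcomp x hx
    exact (hasLogNear_sub hcpt
      (not_isBounded_connectedComponentIn_compl hf hcpt.isClosed hR hu)).div
      (hasLogNear_sub hcpt (not_isBounded_connectedComponentIn_compl hf hcpt.isClosed hR hv))

/-! ### The concrete function and its domains. -/

theorem differentiable_exampleFun : Differentiable ℂ exampleFun := by
  unfold exampleFun
  fun_prop

theorem exampleFun_eq_neg_mul (z : ℂ) :
    exampleFun z = -(z * (10 * Complex.exp (-z) + 1 / 2)) := by
  rw [exampleFun]
  ring

theorem exampleFun_zero : exampleFun 0 = 0 := by simp [exampleFun]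

/-- On `2πiℤ` the function equals `-21z/2`, so a polynomial representing it would be linear; the
value at `πi`, where `exp(-z) = -1`, rules this out. -/
theorem isTranscendentalEntire_exampleFun : IsTranscendentalEntire exampleFun := by
  refine ⟨differentiable_exampleFun, ?_⟩
  rintro ⟨p, hp⟩
  have hI : ∀ k : ℤ, exampleFun (2 * Real.pi * Complex.I * k) =
      (Polynomial.C (-21 / 2) * Polynomial.X : Polynomial ℂ).eval (2 * Real.pi * Complex.I * k) :=
    fun k => by
      have : Complex.exp (-(2 * Real.pi * Complex.I * k)) = 1 :=
        Complex.exp_eq_one_iff.mpr ⟨-k, by push_cast; ring⟩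
      rw [exampleFun_eq_neg_mul, this]
      simp
      ring
  have hinj : Function.Injective fun k : ℤ => (2 * Real.pi * Complex.I * k : ℂ) := fun k l h => by
    have h0 : (2 * Real.pi * Complex.I : ℂ) ≠ 0 := Complex.two_pi_I_ne_zero
    exact_mod_cast mul_left_cancel₀ h0 h
  have hpq : p = Polynomial.C (-21 / 2) * Polynomial.X := by
    refine Polynomial.eq_of_infinite_eval_eq _ _ ((infinite_range_of_injective hinj).mono ?_)
    rintro _ ⟨k, rfl⟩
    exact (hp _).symm.trans (hI k)
  have h1 := hp (Real.pi * Complex.I)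
  have h2 : Complex.exp (-(Real.pi * Complex.I)) = -1 := by
    rw [Complex.exp_neg, Complex.exp_pi_mul_I]
    norm_num
  rw [hpq, exampleFun_eq_neg_mul, h2] at h1
  have h3 : (Real.pi * Complex.I : ℂ) ≠ 0 :=
    mul_ne_zero (by exact_mod_cast Real.pi_ne_zero) Complex.I_ne_zero
  simp only [Polynomial.eval_mul, Polynomial.eval_C, Polynomial.eval_X] at h1
  have h4 : (20 : ℂ) * (Real.pi * Complex.I) = 0 := by linear_combination h1
  exact mul_ne_zero (by norm_num) h3 h4

/-- The form with strict inequalities only makes openness visible despite the `Re z ≤ 0` in the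
definition. -/
theorem mem_exampleDomain_iff {n : ℕ} {z : ℂ} :
    z ∈ exampleDomain n ↔ -(n * Real.pi) < z.re ∧ z.re < 4 * (n * Real.pi) ∧
      |z.im| < 4 * (n * Real.pi) ∧ (0 < z.re ∨ |z.im| < n * Real.pi) := by
  have hn : 0 ≤ n * Real.pi := by positivity
  have h4 : 4 * (n : ℝ) * Real.pi = 4 * (n * Real.pi) := by ring
  have him := abs_nonneg z.im
  simp only [exampleDomain, mem_union, mem_ofPred_eq, h4]
  constructor
  · rintro (⟨h1, h2, h3⟩ | ⟨h1, h2, h3⟩)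
    · exact ⟨by linarith, h2, h3, Or.inl h1⟩
    · exact ⟨h1, by linarith, by linarith, Or.inr h3⟩
  · rintro ⟨h1, h2, h3, h4⟩
    by_cases h : 0 < z.re
    · exact Or.inl ⟨h, h2, h3⟩
    · exact Or.inr ⟨h1, not_lt.mp h, h4.resolve_left h⟩

theorem isOpen_exampleDomain (n : ℕ) : IsOpen (exampleDomain n) := by
  have : exampleDomain n = {z | -(n * Real.pi) < z.re ∧ z.re < 4 * (n * Real.pi) ∧
      |z.im| < 4 * (n * Real.pi) ∧ (0 < z.re ∨ |z.im| < n * Real.pi)} :=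
    ext fun _ => mem_exampleDomain_iff
  rw [this]
  have hre := Complex.continuous_re
  have him := Complex.continuous_im.abs
  exact (isOpen_lt continuous_const hre).inter ((isOpen_lt hre continuous_const).inter
    ((isOpen_lt him continuous_const).inter
      ((isOpen_lt continuous_const hre).union (isOpen_lt him continuous_const))))

theorem isBounded_exampleDomain (n : ℕ) : Bornology.IsBounded (exampleDomain n) := by
  refine isBounded_iff_forall_norm_le.mpr ⟨8 * (n * Real.pi), fun z hz => ?_⟩
  obtain ⟨h1, h2, h3, -⟩ := mem_exampleDomain_iff.mp hz
  have h4 : |z.re| ≤ 4 * (n * Real.pi) := abs_le.mpr ⟨by linarith, h2.le⟩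
  linarith [Complex.norm_le_abs_re_add_abs_im z]

theorem ball_subset_exampleDomain (n : ℕ) :
    Metric.ball 0 (n * Real.pi) ⊆ exampleDomain n := by
  intro z hz
  rw [mem_ball_zero_iff] at hz
  have h1 := abs_le.mp (Complex.abs_re_le_norm z)
  have h2 := Complex.abs_im_le_norm z
  have h3 := norm_nonneg z
  exact mem_exampleDomain_iff.mpr ⟨by linarith, by linarith, by linarith, Or.inr (by linarith)⟩

theorem zero_mem_exampleDomain {n : ℕ} (hn : 0 < n) : (0 : ℂ) ∈ exampleDomain n :=
  ball_subset_exampleDomain n (Metric.mem_ball_self (by positivity))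

theorem starConvex_exampleDomain {n : ℕ} (hn : 0 < n) : StarConvex ℝ 0 (exampleDomain n) := by
  rw [starConvex_zero_iff]
  intro z hz t ht0 ht1
  rcases ht0.eq_or_lt with rfl | ht
  · simpa using zero_mem_exampleDomain hn
  have hnpi : 0 < n * Real.pi := by positivity
  obtain ⟨h1, h2, h3, h4⟩ := mem_exampleDomain_iff.mp hz
  rw [mem_exampleDomain_iff, Complex.smul_re, Complex.smul_im, smul_eq_mul, smul_eq_mul, abs_mul,
    abs_of_pos ht]
  have him : t * |z.im| ≤ |z.im| := mul_le_of_le_one_left (abs_nonneg _) ht1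
  refine ⟨by nlinarith, by nlinarith, by linarith, ?_⟩
  exact h4.imp (fun h => mul_pos ht h) fun h => by linarith

theorem isSimplyConnected_exampleDomain {n : ℕ} (hn : 0 < n) :
    IsSimplyConnected (exampleDomain n) := by
  have : ContractibleSpace (exampleDomain n) :=
    (starConvex_exampleDomain hn).contractibleSpace ⟨0, zero_mem_exampleDomain hn⟩
  exact (inferInstance : SimplyConnectedSpace (exampleDomain n))

theorem frontier_exampleDomain_subset (n : ℕ) {z : ℂ} (hz : z ∈ frontier (exampleDomain n)) :
    (z.re ≤ 0 ∧ n * Real.pi ≤ ‖z‖) ∨ (0 < z.re ∧ |z.im| = 4 * (n * Real.pi)) ∨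
      (z.re = 4 * (n * Real.pi) ∧ |z.im| ≤ 4 * (n * Real.pi)) := by
  rw [(isOpen_exampleDomain n).frontier_eq] at hz
  obtain ⟨hcl, hnot⟩ := hz
  have hre := Complex.continuous_re
  have him := Complex.continuous_im.abs
  have hclosed : IsClosed {z : ℂ | -(n * Real.pi) ≤ z.re ∧ z.re ≤ 4 * (n * Real.pi) ∧
      |z.im| ≤ 4 * (n * Real.pi)} :=
    (isClosed_le continuous_const hre).inter ((isClosed_le hre continuous_const).inter
      (isClosed_le him continuous_const))
  obtain ⟨h1, h2, h3⟩ := closure_minimal (fun w hw => by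
    obtain ⟨h1, h2, h3, -⟩ := mem_exampleDomain_iff.mp hw
    exact ⟨h1.le, h2.le, h3.le⟩) hclosed hcl
  rw [mem_exampleDomain_iff] at hnot
  by_cases h : 0 < z.re
  · right
    by_contra! hcon
    refine hnot ⟨by linarith [mul_nonneg (Nat.cast_nonneg (α := ℝ) n) Real.pi_pos.le],
      h2.lt_of_ne fun h' => absurd (hcon.2 h') (not_lt.mpr h3), h3.lt_of_ne (hcon.1 h), Or.inl h⟩
  · refine Or.inl ⟨not_lt.mp h, ?_⟩
    by_contra! hlt
    exact hnot (mem_exampleDomain_iff.mp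
      (ball_subset_exampleDomain n (mem_ball_zero_iff.mpr hlt)))

/-- On the part in `Re z ≤ 0` the exponential makes the image too large. On the horizontal sides
`exp(-z)` is positive, so the image lies in the left half-plane with imaginary part too large. On
the right side the term `-z/2` dominates and pushes the image past the left edge. -/
theorem exampleFun_notMem_exampleDomain {n : ℕ} (hn : 2 ≤ n) {z : ℂ}
    (hz : z ∈ frontier (exampleDomain n)) : exampleFun z ∉ exampleDomain (n + 1) := by
  intro hw
  obtain ⟨w1, w2, w3, w4⟩ := mem_exampleDomain_iff.mp hw
  have hn' : (2 : ℝ) ≤ n := by exact_mod_cast hn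
  have hpi := Real.pi_gt_three
  set a : ℝ := n * Real.pi with ha
  have ha6 : 6 ≤ a := by nlinarith
  -- This is where `n ≥ 2` matters: `(n + 1) / n ≤ 3 / 2`.
  have hb : ((n + 1 : ℕ) : ℝ) * Real.pi ≤ 3 / 2 * a := by
    push_cast
    nlinarith
  set b : ℝ := ((n + 1 : ℕ) : ℝ) * Real.pi with hbdef
  have hf := exampleFun_eq_neg_mul z
  rcases frontier_exampleDomain_subset n hz with ⟨hre, hna⟩ | ⟨hre, him⟩ | ⟨hre, him⟩
  · have h1 : 1 ≤ ‖Complex.exp (-z)‖ := by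
      rw [Complex.norm_exp, Complex.neg_re]
      exact Real.one_le_exp (by linarith)
    have h2 : 19 / 2 ≤ ‖10 * Complex.exp (-z) + 1 / 2‖ := by
      have := norm_sub_le (10 * Complex.exp (-z) + 1 / 2) (1 / 2)
      rw [add_sub_cancel_right, norm_mul] at this
      norm_num at this ⊢
      linarith
    have h3 : 19 / 2 * a ≤ ‖exampleFun z‖ := by
      rw [hf, norm_neg, norm_mul]
      nlinarith
    -- The next domain lies within radius `4√2 b ≤ 6√2 a`, which is less than `19a/2`.
    have h4 : ‖exampleFun z‖ ^ 2 ≤ 32 * b ^ 2 := by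
      rw [Complex.sq_norm, Complex.normSq_apply]
      have h5 : (exampleFun z).re ^ 2 ≤ (4 * b) ^ 2 :=
        sq_le_sq.mpr ((abs_le.mpr ⟨by linarith, w2.le⟩).trans (le_abs_self _))
      have h6 : (exampleFun z).im ^ 2 ≤ (4 * b) ^ 2 := sq_le_sq.mpr (w3.le.trans (le_abs_self _))
      linarith
    have h7 : (19 / 2 * a) ^ 2 ≤ ‖exampleFun z‖ ^ 2 := by gcongr
    have h8 : b ^ 2 ≤ (3 / 2 * a) ^ 2 := by gcongr
    nlinarith
  · have hexp : Complex.exp (-z) = (Real.exp (-z.re) : ℂ) := by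
      have h1 : ∃ k : ℤ, z.im = k * (2 * Real.pi) := by
        rcases eq_or_eq_neg_of_abs_eq him with h | h
        · exact ⟨2 * n, by rw [h]; push_cast; ring⟩
        · exact ⟨-(2 * n), by rw [h]; push_cast; ring⟩
      obtain ⟨k, hk⟩ := h1
      have h2 : -z = ((-z.re : ℝ) : ℂ) + ((-k : ℤ) : ℂ) * (2 * Real.pi * Complex.I) := by
        conv_lhs => rw [← Complex.re_add_im z, hk]
        push_cast
        ring
      rw [h2, Complex.exp_add, Complex.exp_int_mul_two_pi_mul_I, mul_one, Complex.ofReal_exp]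
    have hf' : exampleFun z = ((-(10 * Real.exp (-z.re) + 1 / 2) : ℝ) : ℂ) * z := by
      rw [hf, hexp]
      push_cast
      ring
    have hE := Real.exp_pos (-z.re)
    rw [hf', Complex.re_ofReal_mul, Complex.im_ofReal_mul, abs_mul, him] at w4
    rw [abs_neg, abs_of_pos (by positivity)] at w4
    rcases w4 with w4 | w4 <;> nlinarith
  · have hE : Real.exp (-z.re) ≤ 1 / 160 := by
      rw [Real.exp_neg, one_div]
      refine inv_anti₀ (by norm_num) ?_
      calc (160 : ℝ) ≤ 2 ^ 8 := by norm_num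
        _ ≤ Real.exp 1 ^ 8 := by
          gcongr
          linarith [Real.add_one_le_exp 1]
        _ = Real.exp 8 := by rw [← Real.exp_nat_mul]; norm_num
        _ ≤ Real.exp z.re := Real.exp_le_exp.mpr (by linarith)
    have hnz : ‖z‖ ≤ 8 * a := by
      have := Complex.norm_le_abs_re_add_abs_im z
      rw [hre, abs_of_pos (by linarith)] at this
      linarith
    have h1 : ‖10 * z * Complex.exp (-z)‖ ≤ a / 2 := by
      rw [norm_mul, norm_mul, Complex.norm_exp, Complex.neg_re]
      norm_num
      nlinarith [norm_nonneg z, Real.exp_pos (-z.re)]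
    have h2 := (abs_le.mp (Complex.abs_re_le_norm (10 * z * Complex.exp (-z)))).1
    have h3 : (exampleFun z).re = -(10 * z * Complex.exp (-z)).re - z.re / 2 := by
      rw [exampleFun, Complex.sub_re, neg_mul, neg_mul, Complex.neg_re]
      simp
    linarith

/-- By the open mapping theorem the boundary of `f(D_n)` lies in `f(∂D_n)`, so the complementary
component of `0 = f(0)` is trapped in the bounded set `f(D_n)`; the connected set `D_{n+1}` lies in
that component. -/
theorem surrounds_exampleDomain {n : ℕ} (hn : 2 ≤ n) :
    Surrounds (exampleFun '' frontier (exampleDomain n)) (exampleDomain (n + 1)) := by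
  have hmiss : exampleDomain (n + 1) ⊆ (exampleFun '' frontier (exampleDomain n))ᶜ := by
    rintro _ hw ⟨z, hz, rfl⟩
    exact exampleFun_notMem_exampleDomain hn hz hw
  have h0 : (0 : ℂ) ∈ exampleDomain (n + 1) := zero_mem_exampleDomain n.succ_pos
  have hopenMap : IsOpenMap exampleFun := by
    refine (AnalyticOnNhd.is_constant_or_isOpenMap fun z _ =>
      differentiable_exampleFun.analyticAt z).resolve_left ?_
    rintro ⟨w, hw⟩
    exact isTranscendentalEntire_exampleFun.2 ⟨Polynomial.C w, by simpa using hw⟩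
  have hopen : IsOpen (exampleFun '' exampleDomain n) := hopenMap _ (isOpen_exampleDomain n)
  have hcpt : IsCompact (exampleFun '' closure (exampleDomain n)) :=
    (isBounded_exampleDomain n).isCompact_closure.image differentiable_exampleFun.continuous
  have hfr : ∀ w ∈ closure (exampleFun '' exampleDomain n),
      w ∉ exampleFun '' frontier (exampleDomain n) → w ∈ exampleFun '' exampleDomain n := by
    intro w hw hwf
    obtain ⟨z, hz, rfl⟩ :=
      closure_minimal (image_mono subset_closure) hcpt.isClosed hw
    refine mem_image_of_mem _ ?_
    by_contra hzD
    refine hwf (mem_image_of_mem _ ?_)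
    rw [(isOpen_exampleDomain n).frontier_eq]
    exact ⟨hz, hzD⟩
  refine ⟨0, hmiss h0, (hcpt.isBounded.subset (image_mono subset_closure)).subset ?_,
    (isSimplyConnected_exampleDomain n.succ_pos).isPathConnected.isConnected.isPreconnected
      |>.subset_connectedComponentIn h0 hmiss⟩
  refine isPreconnected_connectedComponentIn.subset_left_of_subset_union hopen
    (isClosed_closure (s := exampleFun '' exampleDomain n)).isOpen_compl
    (disjoint_compl_right.mono_left subset_closure) (fun w hw => ?_)
    ⟨0, mem_connectedComponentIn (hmiss h0), 0, zero_mem_exampleDomain (by omega), exampleFun_zero⟩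
  by_cases hwc : w ∈ closure (exampleFun '' exampleDomain n)
  · exact Or.inl (hfr w hwc (connectedComponentIn_subset _ _ hw))
  · exact Or.inr hwc

theorem isSurroundingSequence_exampleDomain :
    IsSurroundingSequence exampleFun fun n : ℕ => exampleDomain (n + 2) where
  isOpen n := isOpen_exampleDomain _
  isBounded n := isBounded_exampleDomain _
  isSimplyConnected n := isSimplyConnected_exampleDomain (by omega)
  surrounds n := surrounds_exampleDomain (by omega)
  eventually_ball_subset R := by
    filter_upwards [eventually_ge_atTop ⌈R⌉₊] with n hn
    refine (Metric.ball_subset_ball ?_).trans (ball_subset_exampleDomain _)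
    have h1 : R ≤ n := (Nat.le_ceil R).trans (by exact_mod_cast hn)
    have h2 : (0 : ℝ) ≤ n := n.cast_nonneg
    push_cast
    nlinarith [Real.pi_gt_three]

/-! ### Iterates of the minimum modulus. -/

theorem minModulus_exampleFun_le {r : ℝ} (hr : 5 ≤ r) : minModulus exampleFun r ≤ r := by
  have h1 : minModulus exampleFun r ≤ ‖exampleFun r‖ :=
    (isLeast_minModulus differentiable_exampleFun.continuous (by linarith)).2
      ⟨r, by simp [abs_of_nonneg (by linarith : (0 : ℝ) ≤ r)], rfl⟩
  refine h1.trans ?_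
  have hE : Real.exp (-r) ≤ 1 / 20 := by
    rw [Real.exp_neg, one_div]
    refine inv_anti₀ (by norm_num) ?_
    calc (20 : ℝ) ≤ 2 ^ 5 := by norm_num
      _ ≤ Real.exp 1 ^ 5 := by
        gcongr
        linarith [Real.add_one_le_exp 1]
      _ = Real.exp 5 := by rw [← Real.exp_nat_mul]; norm_num
      _ ≤ Real.exp r := Real.exp_le_exp.mpr hr
  have h2 : exampleFun r = ((-(r * (10 * Real.exp (-r) + 1 / 2)) : ℝ) : ℂ) := by
    rw [exampleFun_eq_neg_mul]
    push_cast
    ring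
  rw [h2, Complex.norm_real, Real.norm_eq_abs, abs_neg,
    abs_of_nonneg (mul_nonneg (by linarith) (by positivity))]
  nlinarith

/-- Once the iterates stay above `5` they are nonincreasing, hence bounded above. -/
theorem not_tendsto_iterate_minModulus_exampleFun (r : ℝ) :
    ¬ Tendsto (fun n : ℕ => (minModulus exampleFun)^[n] r) atTop atTop := by
  intro h
  obtain ⟨N, hN⟩ := eventually_atTop.mp (h.eventually_ge_atTop 5)
  have hle : ∀ n ≥ N, (minModulus exampleFun)^[n] r ≤ (minModulus exampleFun)^[N] r := by
    intro n hn
    induction n, hn using Nat.le_induction with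
    | base => exact le_rfl
    | succ n hn ih =>
      rw [Function.iterate_succ_apply']
      exact (minModulus_exampleFun_le (hN n hn)).trans ih
  obtain ⟨n, hn, hlt⟩ := ((h.eventually_gt_atTop _).and (eventually_ge_atTop N)).exists
  exact absurd (hle n hlt) (not_le.mpr hn)

theorem mainTheorem10 :
    IsTranscendentalEntire exampleFun ∧
      IsSurroundingSequence exampleFun (fun n : ℕ => exampleDomain (n + 2)) ∧
      IsConnected (unboundedOrbitSet exampleFun) ∧
      ¬ ∃ r : ℝ, 0 < r ∧ Tendsto (fun n : ℕ => (minModulus exampleFun)^[n] r) atTop atTop :=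
  have hS := isSurroundingSequence_exampleDomain
  ⟨isTranscendentalEntire_exampleFun, hS,
    isConnected_unboundedOrbitSet differentiable_exampleFun hS.isOpen hS.isBounded
      hS.eventually_ball_subset fun _ _ hz => exampleFun_notMem_exampleDomain (by omega) hz,
    fun ⟨r, _, hr⟩ => not_tendsto_iterate_minModulus_exampleFun r hr⟩
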